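/- Let $N\cong\mathbb Z^n$ with $n\ge 2$. A tropical curve $h\colon\Gamma\to N_{\mathbb R}$ consists of a finite connected graph $\Gamma$ with bounded and unbounded edges (each unbounded edge having one end vertex), positive integer weights $w(E)$, and a proper map $h$ sending vertices to $N_{\mathbb Q}$ and edges affinely to segments or half-lines of rational slope such that at each vertex $V$ the balancing condition $\sum_{E\ni V}w(E)\,u_{(V,E)}=0$ holds, where $u_{(V,E)}\in N$ is the primitive vector along $h(E)$ emanating from $h(V)$. Vertices of any valence, including $2$, are allowed. Let $(\Gamma,h)$ be an *embedded* tropical curve ($h$ is injective) which is *non-superabundant*: if $L^{[1]}$ is the set of edges of the loop part of $\Gamma$ (the bounded edges whose removal lowers the first Betti number), oriented arbitrarily, and $u_E$ is the primitive vector of $E\in L^{[1]}$, then the abundancy map $$\mathbb R^{L^{[1]}}\to \operatorname{Hom}(H_1(\Gamma),N_{\mathbb R}),\qquad (\ell_E)\mapsto\Big(\sum_E a_E[E]\mapsto\sum_E \ell_E a_E u_E\Big)$$ is surjective. Let $\mathscr P$ be an integral polyhedral decomposition of $N_{\mathbb R}$ (finitely many strongly convex rational polyhedra covering $N_{\mathbb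 R}$, closed under faces and meeting along common faces, with all vertices in $N$) respecting $(\Gamma,h)$: after rescaling $h$ by some positive integer (and inserting $2$-valent vertices in $\Gamma$ where necessary), $h(\Gamma)$ is contained in the $1$-skeleton of $\mathscr P$ and $h^{-1}(\mathscr P^{[0]})=\Gamma^{[0]}$. Let $\mathfrak X\to\mathbb C$ be the corresponding toric degeneration, that is, the toric variety of the fan in $N_{\mathbb R}\times\mathbb R$ formed by the closures of the cones over $\Xi\times\{1\}$, $\Xi\in\mathscr P$, and their faces at height $0$, with the projection given by the last coordinate. Let $X_0=\bigcup_{v\in\mathscr P^{[0]}}X_v$ be its central fiber, where $X_v$ is the toric variety of the fan of tangent cones at $v$ of the cells containing $v$. A map $\mathbb P^1\to X_v$ is *torically transverse* if it is holomorphic, misses all toric strata of codimension $>1$, and the preimage of the big torus is dense. For a vertex $V$ of $\Gamma$ with $h(V)=v$, it is *of type $V$*, with marked points $(p_E)_{E\ni V}$, if it is non-constant and torically transverse, the $p_E$ are distinct, it meets at $p_E$ the toric divisor of the ray $\mathbb R_{\ge0}u_{(V,E)}$ with multiplicity $w(E)$, and it meets no toric divisor at any other point. A *pre-log curve* is a stable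 map $\varphi_0\colon C_0\to X_0$ from a prestable (connected nodal) curve whose restriction over each $X_v$ is torically transverse, such that each point of $C_0$ mapped to the singular locus of $X_0$ is a node whose two branches are mapped to different components of $X_0$, with equal intersection indices with the toric divisors through the image point. It is *of type $(\Gamma,h)$* if its components are rational curves $(C_V)_{V\in\Gamma^{[0]}}$, with $\varphi_0|_{C_V}$ mapping to $X_{h(V)}$ and of type $V$, and if $\Gamma$ is its dual intersection graph: the nodes correspond to the bounded edges, the node of an edge $E$ with ends $V,V'$ joining the marked points of $C_V$ and $C_{V'}$ which belong to $E$. Then, for every choice of rational curves $C_{0,V}\to X_{h(V)}$ of type $V$, one for each vertex $V$ of $\Gamma$, there is a pre-log curve $\varphi_0\colon C_0\to X_0$ of type $(\Gamma,h)$ whose component corresponding to $V$ is, for each $V$, isomorphic to $C_{0,V}$ as a rational curve with marked points (labelled by the edges emanating from $V$). -/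

import Mathlib

open scoped Topology

noncomputable section

namespace TropicalPreLog

/-! ## Lattice conventions

`N = ℤ^ι`, `N_ℝ = ℝ^ι`, and the dual lattice `M = Hom(N, ℤ)` is again written as `ℤ^ι`. -/

/-- The pairing of an element of the dual lattice with a real vector. -/
def pairing {ι : Type} [Fintype ι] (m : ι → ℤ) (x : ι → ℝ) : ℝ := ∑ i, (m i : ℝ) * x i

/-- An integral vector, seen as a real vector. -/
def realVec {ι : Type} (u : ι → ℤ) : ι → ℝ := fun i => (u i : ℝ)

/-- A primitive integral vector: it is not a proper integral multiple (in particular not `0`). -/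
def IsPrimitive {ι : Type} (u : ι → ℤ) : Prop := ∀ (k : ℤ) (v : ι → ℤ), u = k • v → IsUnit k

/-- The ray `ℝ_{≥ 0} u`. -/
def rayCone {ι : Type} (u : ι → ℤ) : Set (ι → ℝ) := {x | ∃ t : ℝ, 0 ≤ t ∧ x = t • realVec u}

/-! ## Tropical curves -/

/-- A finite weighted graph. `V` is the set of vertices, `B` the set of bounded edges
(with an auxiliary orientation from `src` to `tgt`; multiple edges and self-loops are allowed),
and `U` the set of unbounded edges, each of which has exactly one end vertex. -/
structure WeightedGraph where
  V : Type
  B : Type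
  U : Type
  finV : Fintype V
  finB : Fintype B
  finU : Fintype U
  src : B → V
  tgt : B → V
  base : U → V
  weightB : B → ℕ
  weightU : U → ℕ
  weightB_pos : ∀ E, 0 < weightB E
  weightU_pos : ∀ E, 0 < weightU E

attribute [instance] WeightedGraph.finV WeightedGraph.finB WeightedGraph.finU

namespace WeightedGraph

variable (G : WeightedGraph)

/-- The graph is non-empty and connected. -/
def IsConnected : Prop :=
  Nonempty G.V ∧
    ∀ x y : G.V, Relation.EqvGen (fun a b => ∃ E : G.B, G.src E = a ∧ G.tgt E = b) x y

/-- A flag, that is an edge together with one of its ends: `(E, false)` is the bounded edge `E`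
at `src E`, `(E, true)` is the bounded edge `E` at `tgt E`, and an unbounded edge gives one flag. -/
abbrev Flag : Type := (G.B × Bool) ⊕ G.U

/-- The vertex of a flag. -/
def flagVertex : G.Flag → G.V
  | Sum.inl (E, false) => G.src E
  | Sum.inl (E, true) => G.tgt E
  | Sum.inr E => G.base E

/-- The weight of the edge of a flag. -/
def flagWeight : G.Flag → ℕ
  | Sum.inl (E, _) => G.weightB E
  | Sum.inr E => G.weightU E

/-- The flags at a vertex, that is the edges emanating from it. -/
abbrev FlagAt (v : G.V) : Type := {f : G.Flag // G.flagVertex f = v}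

open Classical in
/-- The simplicial boundary map from 1-chains to 0-chains. -/
def boundary : (G.B → ℤ) →ₗ[ℤ] (G.V → ℤ) :=
  ∑ E : G.B, (LinearMap.proj E : (G.B → ℤ) →ₗ[ℤ] ℤ).smulRight
    (Pi.single (G.tgt E) (1 : ℤ) - Pi.single (G.src E) (1 : ℤ) : G.V → ℤ)

/-- `H_1(Γ)`: the simplicial 1-cycles. (There are no 2-simplices, and unbounded edges do not
contribute to the homology.) -/
def H1 : Submodule ℤ (G.B → ℤ) := LinearMap.ker G.boundary

/-- The first Betti number. -/
def betti : ℕ := Module.finrank ℤ G.H1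

open Classical in
/-- The graph obtained by removing the interior of a bounded edge. -/
def deleteEdge (E : G.B) : WeightedGraph where
  V := G.V
  B := {E' : G.B // E' ≠ E}
  U := G.U
  finV := G.finV
  finB := inferInstance
  finU := G.finU
  src E' := G.src E'.1
  tgt E' := G.tgt E'.1
  base := G.base
  weightB E' := G.weightB E'.1
  weightU := G.weightU
  weightB_pos E' := G.weightB_pos E'.1
  weightU_pos := G.weightU_pos

/-- The bounded edge `E` is part of a loop: removing its interior lowers the first Betti number. -/
def IsPartOfLoop (E : G.B) : Prop := (G.deleteEdge E).betti < G.betti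

/-- The set of edges of the loop part of the graph. -/
abbrev LoopEdge : Type := {E : G.B // G.IsPartOfLoop E}

end WeightedGraph

/-- A weighted graph with a rational position for each vertex and an integral direction for each
edge (for a bounded edge, the direction is the one from `src E` to `tgt E`). -/
structure DirectedGraphMap (n : ℕ) extends WeightedGraph where
  pos : V → (Fin n → ℚ)
  dirB : B → (Fin n → ℤ)
  dirU : U → (Fin n → ℤ)

/-- The direction of the edge of a flag, emanating from the vertex of the flag. -/
def DirectedGraphMap.flagDir {n : ℕ} (G : DirectedGraphMap n) : G.Flag → (Fin n → ℤ)
  | Sum.inl (E, false) => G.dirB E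
  | Sum.inl (E, true) => - G.dirB E
  | Sum.inr E => G.dirU E

open Classical in
/-- A parametrized tropical curve `h : Γ → ℝ^n` all of whose edges are mapped injectively: the
graph `Γ` is connected, a bounded edge is mapped affinely onto the segment between the positions of
its ends, an unbounded edge is mapped onto a half-line, the directions are the primitive integral
vectors along the edges, and the balancing condition holds at each vertex. -/
structure TropicalCurve (n : ℕ) extends DirectedGraphMap n where
  connected : toWeightedGraph.IsConnected
  dirB_primitive : ∀ E, IsPrimitive (dirB E)
  dirU_primitive : ∀ E, IsPrimitive (dirU E)
  edge : ∀ E, ∃ l : ℚ, 0 < l ∧ ∀ i, pos (tgt E) i = pos (src E) i + l * (dirB E i : ℚ)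
  balanced : ∀ v : V, ∑ f : toWeightedGraph.FlagAt v,
    toWeightedGraph.flagWeight f.1 • toDirectedGraphMap.flagDir f.1 = 0

namespace TropicalCurve

variable {n : ℕ} (T : TropicalCurve n)

/-- The position of a vertex as a real vector. -/
def posR (v : T.V) : Fin n → ℝ := fun i => (T.pos v i : ℝ)

/-- The map `h` on the points of `Γ`; a point of `Γ` is a vertex, an interior point of a bounded
edge (parametrized by the open unit interval), or an interior point of an unbounded edge
(parametrized by the positive reals). -/
def realization :
    T.V ⊕ (T.B × Set.Ioo (0 : ℝ) 1) ⊕ (T.U × Set.Ioi (0 : ℝ)) → (Fin n → ℝ)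
  | Sum.inl v => T.posR v
  | Sum.inr (Sum.inl (E, t)) =>
      (1 - (t : ℝ)) • T.posR (T.src E) + (t : ℝ) • T.posR (T.tgt E)
  | Sum.inr (Sum.inr (E, t)) => T.posR (T.base E) + (t : ℝ) • realVec (T.dirU E)

/-- The tropical curve is embedded. (The map `h` is continuous and proper, so that it is an
embedding if and only if it is injective.) -/
def IsEmbedded : Prop := Function.Injective T.realization

open Classical in
/-- The abundancy map
`ℝ^{L^{[1]}} → Hom(H_1(Γ), N_ℝ)`, `(l_E) ↦ (∑ a_E [E] ↦ ∑ l_E a_E u_E)`,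
where the sums are over the edges of the loop part (every cycle is supported there). -/
def abundancyMap : (T.LoopEdge → ℝ) → (T.H1 →ₗ[ℤ] (Fin n → ℝ)) := fun l =>
  ∑ E : T.LoopEdge, ((LinearMap.proj E.1 : (T.B → ℤ) →ₗ[ℤ] ℤ).comp T.H1.subtype).smulRight
    (l E • realVec (T.dirB E.1))

/-- Non-superabundancy: the abundancy map is surjective. -/
def IsNonSuperabundant : Prop := Function.Surjective T.abundancyMap

end TropicalCurve

/-! ## The complex projective line -/

/-- The Riemann sphere. Its automorphism group is `GL(2, ℂ)` (modulo scalars), acting by Möbius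
transformations; Mathlib's action is used. -/
abbrev P1 : Type := OnePoint ℂ

/-- A holomorphic coordinate of the Riemann sphere centred at `p`. -/
def P1.chart (p : P1) (z : ℂ) : P1 :=
  p.elim (if z = 0 then OnePoint.infty else ((z⁻¹ : ℂ) : P1)) (fun a => ((a + z : ℂ) : P1))

/-! ## Toric varieties and holomorphic maps to them -/

/-- The set of complex points of the toric variety of a fan `𝓕` in `ℝ^ι` (with the lattice `ℤ^ι`).
The toric variety is the disjoint union of the torus orbits `O_τ = Hom(τ^⊥ ∩ M, ℂ^*)`, for
`τ ∈ 𝓕`. A point of `O_τ` is recorded by the cone `τ` and by the extension by zero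
`ev : M → ℂ` of the homomorphism `τ^⊥ ∩ M → ℂ^*`. If `τ` is a face of `σ ∈ 𝓕`, so that `O_τ` is
contained in the affine chart `U_σ = Hom(σ^∨ ∩ M, ℂ)`, then `ev m` is the value of the regular
function `χ^m` at the point, for each `m ∈ σ^∨ ∩ M`. -/
@[ext]
structure ToricVariety {ι : Type} [Fintype ι] (𝓕 : Set (Set (ι → ℝ))) where
  cone : Set (ι → ℝ)
  cone_mem : cone ∈ 𝓕
  ev : (ι → ℤ) → ℂ
  ev_ne_zero_iff : ∀ m, ev m ≠ 0 ↔ ∀ x ∈ cone, pairing m x = 0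
  ev_add : ∀ m m', (∀ x ∈ cone, pairing m x = 0) → (∀ x ∈ cone, pairing m' x = 0) →
    ev (m + m') = ev m * ev m'

section ToricMaps

variable {ι : Type} [Fintype ι] {𝓕 : Set (Set (ι → ℝ))}

/-- Holomorphic maps from the Riemann sphere to a toric variety: near each point `p`, the map has
values in an affine chart `U_σ` (the union of the orbits of the faces of `σ`), and the pullbacks of
the regular functions `χ^m`, `m ∈ σ^∨ ∩ M`, on this chart are holomorphic at `p`. -/
def IsHolomorphic (f : P1 → ToricVariety 𝓕) : Prop :=
  ∀ p : P1, ∃ σ ∈ 𝓕, (∀ᶠ z in 𝓝 (0 : ℂ), (f (p.chart z)).cone ⊆ σ) ∧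
    ∀ m : ι → ℤ, (∀ x ∈ σ, 0 ≤ pairing m x) →
      AnalyticAt ℂ (fun z : ℂ => (f (p.chart z)).ev m) 0

/-- A torically transverse map from the Riemann sphere: it is holomorphic, the preimage of the big
torus (the orbit of the cone `0`) is dense, and the image is disjoint from the toric strata of
codimension greater than `1`. -/
def IsToricallyTransverse (f : P1 → ToricVariety 𝓕) : Prop :=
  IsHolomorphic f ∧ Dense {p : P1 | (f p).cone = {0}} ∧
    ∀ p : P1, Module.finrank ℝ (Submodule.span ℝ (f p).cone) ≤ 1

/-- At the point `p`, the map `f` meets the toric divisor of the ray spanned by the primitive vector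
`u` (and no other toric divisor), with intersection multiplicity `w`. A local equation of the divisor
at a point of its open orbit is `χ^m`, for any `m` with `⟨m, u⟩ = 1`. -/
def MeetsDivisor (f : P1 → ToricVariety 𝓕) (p : P1) (u : ι → ℤ) (w : ℕ) : Prop :=
  IsPrimitive u ∧ (f p).cone = rayCone u ∧
    ∀ m : ι → ℤ, (∑ i, m i * u i) = 1 →
      analyticOrderAt (fun z : ℂ => (f (p.chart z)).ev m) 0 = (w : ℕ∞)

/-- Rational curves of the type of a tropical curve with a single vertex and with edges `e : A`
of directions `u e` and weights `w e`, with marked points `p e`: a non-constant torically transverse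
map which meets, for each edge `e`, the toric divisor of the ray of `u e` at the point `p e` with
multiplicity `w e`, the points `p e` being distinct, and which does not meet the toric
divisors anywhere else. -/
structure IsOfVertexType {A : Type} (f : P1 → ToricVariety 𝓕) (u : A → (ι → ℤ)) (w : A → ℕ)
    (p : A → P1) : Prop where
  nonconstant : ∃ q q', f q ≠ f q'
  transverse : IsToricallyTransverse f
  injective : Function.Injective p
  meets : ∀ e, MeetsDivisor f (p e) (u e) (w e)
  only : ∀ q, q ∉ Set.range p → (f q).cone = {0}

end ToricMaps

/-! ## Polyhedral decompositions and toric degenerations -/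

/-- A rational polyhedron: a finite intersection of rational closed half-spaces. -/
def IsRationalPolyhedron {n : ℕ} (Ξ : Set (Fin n → ℝ)) : Prop :=
  ∃ s : Finset ((Fin n → ℤ) × ℤ), Ξ = {x | ∀ c ∈ s, (c.2 : ℝ) ≤ pairing c.1 x}

/-- An integral polyhedral decomposition of `ℝ^n`: a finite set of non-empty, strongly convex
rational polyhedra (the cells) covering `ℝ^n`, closed under taking non-empty faces, such that two
cells are disjoint or meet in a common face, and such that all the vertices are lattice points. -/
structure PolyhedralDecomposition (n : ℕ) where
  cells : Set (Set (Fin n → ℝ))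
  finite : cells.Finite
  nonempty : ∀ Ξ ∈ cells, Ξ.Nonempty
  polyhedron : ∀ Ξ ∈ cells, IsRationalPolyhedron Ξ
  no_line : ∀ Ξ ∈ cells, ∀ x d : Fin n → ℝ, (∀ t : ℝ, x + t • d ∈ Ξ) → d = 0
  cover : ⋃₀ cells = Set.univ
  face_mem : ∀ Ξ ∈ cells, ∀ F : Set (Fin n → ℝ), F.Nonempty → IsExposed ℝ Ξ F → F ∈ cells
  inter_face : ∀ Ξ ∈ cells, ∀ Ξ' ∈ cells, IsExposed ℝ Ξ (Ξ ∩ Ξ')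
  integral : ∀ x : Fin n → ℝ, {x} ∈ cells → ∃ v : Fin n → ℤ, x = realVec v

/-- The recession (asymptotic) cone of a polyhedron. -/
def recessionCone {n : ℕ} (Ξ : Set (Fin n → ℝ)) : Set (Fin n → ℝ) :=
  {y | ∀ x ∈ Ξ, ∀ t : ℝ, 0 ≤ t → x + t • y ∈ Ξ}

/-- The closure of the cone over `Ξ × {1}` in `ℝ^n × ℝ`. -/
def coneOver {n : ℕ} (Ξ : Set (Fin n → ℝ)) : Set (Fin n ⊕ Unit → ℝ) :=
  {z | (0 < z (Sum.inr ()) ∧ (z (Sum.inr ()))⁻¹ • (z ∘ Sum.inl) ∈ Ξ) ∨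
    (z (Sum.inr ()) = 0 ∧ z ∘ Sum.inl ∈ recessionCone Ξ)}

/-- The asymptotic cone of `Ξ`, at height `0` in `ℝ^n × ℝ`. -/
def coneAtInfinity {n : ℕ} (Ξ : Set (Fin n → ℝ)) : Set (Fin n ⊕ Unit → ℝ) :=
  {z | z (Sum.inr ()) = 0 ∧ z ∘ Sum.inl ∈ recessionCone Ξ}

/-- Extending an integral vector by a last coordinate. -/
def extend {n : ℕ} (m : Fin n → ℤ) (k : ℤ) : Fin n ⊕ Unit → ℤ := Sum.elim m (fun _ => k)

namespace PolyhedralDecomposition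

variable {n : ℕ} (P : PolyhedralDecomposition n)

/-- The vertices of the decomposition. -/
abbrev Vertex : Type := {v : Fin n → ℤ // {realVec v} ∈ P.cells}

/-- The fan in `ℝ^n × ℝ` of the toric degeneration. -/
def degenerationFan : Set (Set (Fin n ⊕ Unit → ℝ)) :=
  {κ | ∃ Ξ ∈ P.cells, κ = coneOver Ξ ∨ κ = coneAtInfinity Ξ}

/-- The total space `𝔛` of the toric degeneration. -/
abbrev TotalSpace : Type := ToricVariety P.degenerationFan

/-- The projection `𝔛 → ℂ`, given by the monomial of the last coordinate. -/
def projection (x : P.TotalSpace) : ℂ := x.ev (extend 0 1)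

/-- The central fiber `X_0`. -/
def centralFiber : Set P.TotalSpace := {x | P.projection x = 0}

/-- The component `X_v` of the central fiber, for a vertex `v`: the closure of the orbit of the ray
spanned by `(v, 1)`, that is the union of the orbits of the cones which contain `(v, 1)`. -/
def component (v : P.Vertex) : Set P.TotalSpace :=
  {x | realVec (extend v.1 1) ∈ x.cone}

/-- The projection `ℝ^n × ℝ → ℝ^n` along `(v, 1)`. -/
def projAlong (v : P.Vertex) (z : Fin n ⊕ Unit → ℝ) : Fin n → ℝ :=
  z ∘ Sum.inl - z (Sum.inr ()) • realVec v.1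

/-- The fan of the toric variety `X_v`: the projections along `(v, 1)` of the cones which contain
`(v, 1)`, or, in other words, the tangent cones at `v` of the cells which contain `v`. -/
def starFan (v : P.Vertex) : Set (Set (Fin n → ℝ)) :=
  {σ | ∃ κ ∈ P.degenerationFan, realVec (extend v.1 1) ∈ κ ∧ σ = P.projAlong v '' κ}

theorem pairing_extend (v : P.Vertex) (m : Fin n → ℤ) (z : Fin n ⊕ Unit → ℝ) :
    pairing (extend m (- ∑ i, m i * v.1 i)) z = pairing m (P.projAlong v z) := by
  have h : ∀ i, (m i : ℝ) * (z (Sum.inl i) - z (Sum.inr ()) * (v.1 i : ℝ)) =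
      (m i : ℝ) * z (Sum.inl i) - ((m i : ℝ) * (v.1 i : ℝ)) * z (Sum.inr ()) := fun i => by ring
  have h' : pairing m (P.projAlong v z) = ∑ i, (m i : ℝ) * z (Sum.inl i) -
      (∑ i, (m i : ℝ) * (v.1 i : ℝ)) * z (Sum.inr ()) := by
    rw [Finset.sum_mul, ← Finset.sum_sub_distrib]
    exact Finset.sum_congr rfl fun i _ => h i
  rw [h']
  simp [pairing, extend, sub_eq_add_neg]

theorem component_subset_centralFiber (v : P.Vertex) : P.component v ⊆ P.centralFiber := by
  intro x hx
  by_contra h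
  have h1 := (x.ev_ne_zero_iff _).1 h _ hx
  simp [pairing, extend, realVec] at h1

/-- The identification of the component `X_v` with the toric variety of the fan `starFan v`.
The character lattice of the orbits of `X_v` is identified by `m ↦ (m, - ⟨m, v⟩)` with the
orthogonal complement of `(v, 1)`. -/
def toToric (v : P.Vertex) (x : P.component v) : ToricVariety (P.starFan v) where
  cone := P.projAlong v '' x.1.cone
  cone_mem := ⟨x.1.cone, x.1.cone_mem, x.2, rfl⟩
  ev m := x.1.ev (extend m (- ∑ i, m i * v.1 i))
  ev_ne_zero_iff m := by
    rw [x.1.ev_ne_zero_iff]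
    simp only [pairing_extend, Set.forall_mem_image]
  ev_add m m' hm hm' := by
    rw [Set.forall_mem_image] at hm hm'
    rw [← x.1.ev_add _ _ (fun z hz => by rw [pairing_extend]; exact hm hz)
      (fun z hz => by rw [pairing_extend]; exact hm' hz)]
    congr 1
    funext i
    cases i with
    | inl i => simp [extend]
    | inr i => simp [extend, add_mul, Finset.sum_add_distrib]; ring

/-- The locus where the central fiber is singular because at least two of its components meet. (The
remaining singular points are toric singularities of the components, which lie in strata of
codimension greater than `1` of the components and are never met by torically transverse
curves.) -/
def singularLocus : Set P.TotalSpace :=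
  {x | ∃ v v' : P.Vertex, v ≠ v' ∧ x ∈ P.component v ∧ x ∈ P.component v'}

end PolyhedralDecomposition

/-- The decomposition `P` defines a toric degeneration respecting the tropical curve `T`: for some
positive integer `scale` (one passes from rational to integral vertices by a rescaling), the map
`scale • h` is cellular. This means that its image is in the `1`-skeleton of `P` and
that the vertices of `P` on the image are exactly the images of the vertices of `Γ`, where `Γ` may
have `2`-valent vertices. -/
structure Respects {n : ℕ} (P : PolyhedralDecomposition n) (T : TropicalCurve n) where
  scale : ℕ
  scale_pos : 0 < scale
  vertex : T.V → P.Vertex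
  vertex_eq : ∀ v, realVec (vertex v).1 = (scale : ℝ) • T.posR v
  edgeB_mem : ∀ E, segment ℝ (realVec (vertex (T.src E)).1) (realVec (vertex (T.tgt E)).1) ∈ P.cells
  edgeU_mem : ∀ E, {x | ∃ t : ℝ, 0 ≤ t ∧
    x = realVec (vertex (T.base E)).1 + t • realVec (T.dirU E)} ∈ P.cells

/-! ## Pre-log curves -/

/-- A (complete, connected) prestable curve all of whose components have the Riemann sphere as
normalization: the nodal curve obtained from the disjoint union of finitely many
Riemann spheres `{i} × P1` by gluing, for each node `k`, the two points `branch k false` and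
`branch k true`. -/
structure PrestableCurve where
  comp : Type
  node : Type
  finComp : Finite comp
  finNode : Finite node
  branch : node → Bool → comp × P1
  branch_injective : Function.Injective (fun kb : node × Bool => branch kb.1 kb.2)
  nonempty : Nonempty comp
  connected : ∀ i j : comp, Relation.EqvGen
    (fun a b => ∃ k, (branch k false).1 = a ∧ (branch k true).1 = b) i j

/-- A pre-log curve `φ_0 : C_0 → X_0` on the central fiber (with components of `C_0` as above). It is
given by its restrictions `map i` to the normalizations of the components; as the restrictions of
`φ_0` over each `X_v` are torically transverse, each component is mapped to exactly one `X_v`. -/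
structure PreLogCurve {n : ℕ} (P : PolyhedralDecomposition n) extends PrestableCurve where
  vertex : comp → P.Vertex
  map : (i : comp) → P1 → P.component (vertex i)
  /-- The maps are compatible with the gluing at the nodes. -/
  glue : ∀ k, (map (branch k false).1 (branch k false).2).1 =
    (map (branch k true).1 (branch k true).2).1
  /-- Stability: a contracted component has at least three special points. -/
  stable : ∀ i, (∃ x, ∀ q, map i q = x) →
    3 ≤ Nat.card {kb : node × Bool // (branch kb.1 kb.2).1 = i}
  /-- Torical transversality over each component of the central fiber. -/
  transverse : ∀ i, IsToricallyTransverse (fun q => P.toToric (vertex i) (map i q))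
  /-- The points mapped to the singular locus are nodes. -/
  node_of_singular : ∀ i q, (map i q).1 ∈ P.singularLocus → ∃ k b, branch k b = (i, q)
  /-- At the nodes mapped to the singular locus, the two branches are mapped to different components
  and have the same intersection index with the toric divisor. -/
  node_condition : ∀ k, (map (branch k false).1 (branch k false).2).1 ∈ P.singularLocus →
    vertex (branch k false).1 ≠ vertex (branch k true).1 ∧
    ∃ (w : ℕ) (u u' : Fin n → ℤ),
      MeetsDivisor (fun q => P.toToric (vertex (branch k false).1) (map (branch k false).1 q))
        (branch k false).2 u w ∧
      MeetsDivisor (fun q => P.toToric (vertex (branch k true).1) (map (branch k true).1 q))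
        (branch k true).2 u' w

/-- A curve in the component of the central fiber which belongs to the vertex `v` of the tropical
curve, with one marked point for each edge emanating from `v`, is of type `v`. -/
def IsOfTypeAt {n : ℕ} {P : PolyhedralDecomposition n} {T : TropicalCurve n} (R : Respects P T)
    (v : T.V) (f : P1 → P.component (R.vertex v)) (mark : T.FlagAt v → P1) : Prop :=
  IsOfVertexType (fun q => P.toToric (R.vertex v) (f q))
    (fun e => T.flagDir e.1) (fun e => T.flagWeight e.1) mark

/-- The pre-log curve `φ` is of type `(Γ, h)`, for an embedded tropical curve: its components
correspond to the vertices of `Γ`, the component of `v` is mapped to the component of the central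
fiber which belongs to `v` and is a curve of type `v`, and `Γ` is the dual intersection graph: the
nodes correspond to the bounded edges, and the node of `E` joins the marked points which belong to
the two flags of `E`. The marked points are part of the data. -/
structure PreLogCurve.OfType {n : ℕ} {P : PolyhedralDecomposition n} {T : TropicalCurve n}
    (R : Respects P T) (φ : PreLogCurve P) where
  comp : T.V ≃ φ.comp
  node : T.B ≃ φ.node
  mark : (v : T.V) → T.FlagAt v → P1
  map : (v : T.V) → P1 → P.component (R.vertex v)
  vertex_eq : ∀ v, φ.vertex (comp v) = R.vertex v
  /-- `map v` is the restriction of `φ` to the component of `v`. -/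
  map_eq : ∀ v q, (map v q).1 = (φ.map (comp v) q).1
  type : ∀ v, IsOfTypeAt R v (map v) (mark v)
  node_eq : ∀ E,
    s(φ.branch (node E) false, φ.branch (node E) true) =
      s((comp (T.src E), mark (T.src E) ⟨Sum.inl (E, false), rfl⟩),
        (comp (T.tgt E), mark (T.tgt E) ⟨Sum.inl (E, true), rfl⟩))

end TropicalPreLog

end

open TropicalPreLog

/-! The given curves need not agree at the nodes, but each may be moved by a point `exp a_V` of the
torus. This changes neither its type nor its marked points, so it suffices to choose the `a_V` so
that the moved curves match. For a bounded edge `E` from `V` to `V'` with direction `u_E`, both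
marked points lie in the orbit of the cone over the segment of `E` (`IsOfTypeAt.cone_mark`). The
torus acts transitively on this orbit, and the one-parameter subgroup of `u_E` acts trivially.
Taking logarithms, the two points agree once `a_V' - a_V = b_E + l_E u_E` for some complex `l_E`,
where `b_E` measures their discrepancy (`exists_expAct_eq`). So the cochain `b` has to become a
coboundary after correction along the edge directions. The obstruction is the homomorphism that `b`
induces on `H_1(Γ)`, and surjectivity of the abundancy map says exactly that suitable `l_E` cancel
it (`exists_potential`, `IsNonSuperabundant.exists_complex`). The matched curves then glue, and the
singular locus is met only at the nodes (`IsOfTypeAt.exists_bounded`). -/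

namespace TropicalPreLog

/-! ## Extension of homomorphisms to rational vector spaces -/

/-- A homomorphism to a rational vector space factors through every homomorphism with smaller
kernel. -/
theorem exists_comp_eq_of_ker_le {M N A : Type} [AddCommGroup M] [AddCommGroup N] [AddCommGroup A]
    [Module ℚ A] (f : M →ₗ[ℤ] N) (g : M →ₗ[ℤ] A) (h : LinearMap.ker f ≤ LinearMap.ker g) :
    ∃ k : N →ₗ[ℤ] A, k ∘ₗ f = g := by
  -- A rational vector space is divisible, hence an injective abelian group by Baer's criterion. The
  -- map induced by `g` on `M / ker f` therefore extends along the embedding of `M / ker f` into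
  -- `N`.
  let _ : DivisibleBy A ℤ :=
    { div := fun a m => (m : ℚ)⁻¹ • a
      div_zero := fun a => by simp
      div_cancel := fun {m} a hm => by
        rw [← Int.cast_smul_eq_zsmul ℚ, smul_smul, mul_inv_cancel₀ (by exact_mod_cast hm),
          one_smul] }
  have hA : Module.Baer ℤ A := Module.Baer.of_divisible A
  obtain ⟨k, hk⟩ := hA.extension_property ((LinearMap.ker f).liftQ f le_rfl)
    (LinearMap.ker_eq_bot.1 (Submodule.ker_liftQ_eq_bot' _ _ rfl))
    ((LinearMap.ker f).liftQ g h)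
  refine ⟨k, LinearMap.ext fun x => ?_⟩
  simpa using LinearMap.congr_fun hk (Submodule.Quotient.mk x)

/-- A 1-cochain with values in a rational vector space which vanishes on all cycles is a
coboundary. -/
theorem WeightedGraph.exists_potential (G : WeightedGraph) {A : Type} [AddCommGroup A] [Module ℚ A]
    (b : G.B → A) (hb : ∀ a ∈ G.H1, ∑ E, a E • b E = 0) :
    ∃ p : G.V → A, ∀ E, p (G.tgt E) - p (G.src E) = b E := by
  classical
  -- As a homomorphism on 1-chains, `b` kills the kernel of the boundary map, so it factors through
  -- 0-chains; the values of the factor `k` on the vertices form the potential.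
  obtain ⟨k, hk⟩ := exists_comp_eq_of_ker_le G.boundary (Fintype.linearCombination ℤ b)
    (fun a ha => by
      rw [LinearMap.mem_ker, Fintype.linearCombination_apply]
      exact hb a ha)
  refine ⟨fun v => k (Pi.single v 1), fun E => ?_⟩
  have h1 := LinearMap.congr_fun hk (Pi.single E 1)
  rw [LinearMap.comp_apply, Fintype.linearCombination_apply_single, one_smul] at h1
  rw [← h1, ← map_sub]
  congr 1
  rw [WeightedGraph.boundary, LinearMap.sum_apply, Finset.sum_eq_single E]
  · simp only [LinearMap.smulRight_apply, LinearMap.proj_apply, Pi.single_eq_same, one_smul]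
  · intro E' _ hE'
    simp [Pi.single_eq_of_ne hE']
  · simp

/-- A homomorphism from a sublattice of `ℤ^ι` to `ℂ^*` is the restriction of the exponential of a
linear form. -/
theorem exists_exp_eq {ι : Type} [Fintype ι] (L : Submodule ℤ (ι → ℤ)) (c : (ι → ℤ) → ℂ)
    (h0 : ∀ m ∈ L, c m ≠ 0) (hadd : ∀ m ∈ L, ∀ m' ∈ L, c (m + m') = c m * c m') :
    ∃ b : ι → ℂ, ∀ m ∈ L, Complex.exp (∑ i, (m i : ℂ) * b i) = c m := by
  classical
  -- A sublattice is free, so logarithms may be chosen on a basis of `L` and extended linearly to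
  -- `lam`. Multiplicativity of `c` then gives `exp ∘ lam = c` on all of `L`.
  let e := Module.Free.chooseBasis ℤ L
  let lam : L →ₗ[ℤ] ℂ := e.constr ℤ fun i => Complex.log (c (e i))
  let cU : L →+ Additive ℂˣ := AddMonoidHom.mk'
    (fun x => Additive.ofMul (Units.mk0 (c x) (h0 x x.2)))
    (fun x y => by
      rw [← ofMul_mul]
      exact congrArg _ (Units.ext (hadd x x.2 y y.2)))
  let eU : L →+ Additive ℂˣ := AddMonoidHom.mk'
    (fun x => Additive.ofMul (Units.mk0 (Complex.exp (lam x)) (Complex.exp_ne_zero _)))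
    (fun x y => by
      rw [← ofMul_mul]
      refine congrArg _ (Units.ext ?_)
      simp [Complex.exp_add])
  have hU : eU.toIntLinearMap = cU.toIntLinearMap := by
    refine e.ext fun i => ?_
    change Additive.ofMul _ = Additive.ofMul _
    refine congrArg _ (Units.ext ?_)
    change Complex.exp (lam (e i)) = c (e i)
    rw [Module.Basis.constr_basis, Complex.exp_log (h0 _ (e i).2)]
  have hexp : ∀ x : L, Complex.exp (lam x) = c x := fun x =>
    congrArg (fun y : Additive ℂˣ => ((Additive.toMul y : ℂˣ) : ℂ)) (LinearMap.congr_fun hU x)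
  -- The logarithm extends from `L` to the whole lattice, even if `L` is not saturated, because `ℂ`
  -- is divisible.
  obtain ⟨k, hk⟩ := exists_comp_eq_of_ker_le L.subtype lam (by simp)
  refine ⟨fun i => k (Pi.single i 1), fun m hm => ?_⟩
  rw [← hexp ⟨m, hm⟩, ← hk, LinearMap.comp_apply, Submodule.subtype_apply,
    LinearMap.pi_apply_eq_sum_univ k m]
  congr 1
  refine Finset.sum_congr rfl fun i _ => ?_
  rw [zsmul_eq_mul]
  refine congrArg (fun x => (m i : ℂ) * k x) (funext fun j => ?_)
  simp [Pi.single_apply, eq_comm]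

/-! ## Solving the matching conditions for a non-superabundant curve -/

namespace TropicalCurve

variable {n : ℕ} (T : TropicalCurve n)

/-- On a non-superabundant curve, every real 1-cochain is a coboundary up to the edge directions. -/
theorem IsNonSuperabundant.exists_real (hns : T.IsNonSuperabundant) (b : T.B → Fin n → ℝ) :
    ∃ (a : T.V → Fin n → ℝ) (l : T.B → ℝ),
      ∀ E, a (T.tgt E) - a (T.src E) = b E + l E • realVec (T.dirB E) := by
  classical
  obtain ⟨l, hl⟩ := hns ((Fintype.linearCombination ℤ b).comp T.H1.subtype)
  -- The sign makes the correction cancel the periods of `b`. Edges outside the loop part get `0`,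
  -- in accordance with the range of the sum in `abundancyMap`.
  let l' : T.B → ℝ := fun E => if h : T.IsPartOfLoop E then - l ⟨E, h⟩ else 0
  obtain ⟨p, hp⟩ := T.exists_potential (fun E => b E + l' E • realVec (T.dirB E)) (by
    intro a ha
    have h1 := LinearMap.congr_fun hl ⟨a, ha⟩
    rw [abundancyMap, LinearMap.sum_apply] at h1
    simp only [LinearMap.smulRight_apply, LinearMap.comp_apply, Submodule.subtype_apply,
      LinearMap.proj_apply, Fintype.linearCombination_apply] at h1
    simp only [smul_add, Finset.sum_add_distrib, ← h1]
    have h2 : ∑ E : T.B, a E • l' E • realVec (T.dirB E) =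
        ∑ E : T.LoopEdge, a E.1 • l' E.1 • realVec (T.dirB E.1) := by
      refine (Fintype.sum_of_injective Subtype.val Subtype.val_injective _ _ (fun E hE => ?_)
        fun E => rfl).symm
      have hE' : ¬ T.IsPartOfLoop E := fun h => hE ⟨⟨E, h⟩, rfl⟩
      simp [l', hE']
    rw [h2, ← Finset.sum_add_distrib]
    refine Finset.sum_eq_zero fun E _ => ?_
    simp [l', E.2])
  exact ⟨p, l', hp⟩

/-- On a non-superabundant curve, every complex 1-cochain is a coboundary up to the edge
directions. -/
theorem IsNonSuperabundant.exists_complex (hns : T.IsNonSuperabundant) (b : T.B → Fin n → ℂ) :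
    ∃ (a : T.V → Fin n → ℂ) (l : T.B → ℂ),
      ∀ E i, a (T.tgt E) i - a (T.src E) i = b E i + l E * (T.dirB E i : ℂ) := by
  -- The edge directions are real, so the real and imaginary parts of the system decouple.
  obtain ⟨a, l, h⟩ := hns.exists_real T fun E i => (b E i).re
  obtain ⟨a', l', h'⟩ := hns.exists_real T fun E i => (b E i).im
  refine ⟨fun v i => ⟨a v i, a' v i⟩, fun E => ⟨l E, l' E⟩, fun E i => ?_⟩
  have h1 := congrFun (h E) i
  have h2 := congrFun (h' E) i
  apply Complex.ext <;> simpa [realVec] using by assumption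

end TropicalCurve

/-! ## Edges of polyhedral decompositions -/

theorem IsPrimitive.ne_zero {ι : Type} {u : ι → ℤ} (hu : IsPrimitive u) : u ≠ 0 := by
  rintro rfl
  simpa using hu 0 0 (by simp)

theorem realVec_ne_zero {ι : Type} {u : ι → ℤ} (hu : u ≠ 0) : realVec u ≠ 0 := fun h =>
  hu (funext fun i => by simpa [realVec] using congrFun h i)

theorem realVec_injective {ι : Type} : Function.Injective (realVec : (ι → ℤ) → ι → ℝ) :=
  fun u v h => funext fun i => by simpa [realVec] using congrFun h i

theorem IsRationalPolyhedron.convex {n : ℕ} {Ξ : Set (Fin n → ℝ)} (h : IsRationalPolyhedron Ξ) :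
    Convex ℝ Ξ := by
  obtain ⟨s, rfl⟩ := h
  intro x hx y hy a b ha hb hab c hc
  have h1 : pairing c.1 (a • x + b • y) = a * pairing c.1 x + b * pairing c.1 y := by
    simp only [pairing, Finset.mul_sum, ← Finset.sum_add_distrib]
    exact Finset.sum_congr rfl fun i _ => by simp; ring
  rw [h1]
  have hx' := mul_le_mul_of_nonneg_left (hx c hc) ha
  have hy' := mul_le_mul_of_nonneg_left (hy c hc) hb
  have : (c.2 : ℝ) = a * c.2 + b * c.2 := by rw [← add_mul, hab, one_mul]
  linarith

/-- The half-line from `v` in the direction `u`. -/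
def halfLine {n : ℕ} (v u : Fin n → ℝ) : Set (Fin n → ℝ) := {x | ∃ t : ℝ, 0 ≤ t ∧ x = v + t • u}

/-- The set `Ξ` is a segment or a half-line which emanates from `v` in the direction `u`. -/
structure Emanates {n : ℕ} (Ξ : Set (Fin n → ℝ)) (v u : Fin n → ℝ) : Prop where
  base_mem : v ∈ Ξ
  subset : Ξ ⊆ halfLine v u
  pos_mem : ∃ s : ℝ, 0 < s ∧ v + s • u ∈ Ξ

namespace PolyhedralDecomposition

variable {n : ℕ} (P : PolyhedralDecomposition n)

theorem add_smul_mem_of_convex {Ξ : Set (Fin n → ℝ)} (hΞ : Convex ℝ Ξ) {v u : Fin n → ℝ}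
    {s t : ℝ} (hv : v ∈ Ξ) (hs : v + s • u ∈ Ξ) (ht : 0 ≤ t) (hts : t ≤ s) : v + t • u ∈ Ξ := by
  rcases eq_or_lt_of_le (ht.trans hts) with h0 | h0
  · obtain rfl : t = 0 := by linarith
    simpa using hv
  · have := hΞ.add_smul_mem hv hs (t := t / s) ⟨by positivity, (div_le_one h0).2 hts⟩
    rwa [smul_smul, div_mul_cancel₀ _ h0.ne'] at this

/-- By convexity, both cells contain a common initial segment from `v`. For `y` in `Ξ` beyond it,
the end of this segment lies strictly between `v` and `y` and belongs to the face `Ξ ∩ Ξ'` of `Ξ`;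
faces are extreme, so `y` belongs to it too. -/
theorem subset_of_emanates {Ξ Ξ' : Set (Fin n → ℝ)} (hΞ : Ξ ∈ P.cells) (hΞ' : Ξ' ∈ P.cells)
    {v u : Fin n → ℝ} (h : Emanates Ξ v u) (h' : Emanates Ξ' v u) : Ξ ⊆ Ξ' := by
  have hc := (P.polyhedron Ξ hΞ).convex
  have hc' := (P.polyhedron Ξ' hΞ').convex
  obtain ⟨s, hs, hsm⟩ := h.pos_mem
  obtain ⟨s', hs', hsm'⟩ := h'.pos_mem
  have hm : 0 < min s s' := lt_min hs hs'
  have h1 := add_smul_mem_of_convex hc h.base_mem hsm hm.le (min_le_left _ _)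
  have h2 := add_smul_mem_of_convex hc' h'.base_mem hsm' hm.le (min_le_right _ _)
  intro y hy
  obtain ⟨t, ht, rfl⟩ := h.subset hy
  rcases le_or_gt t (min s s') with hle | hgt
  · exact add_smul_mem_of_convex hc' h'.base_mem h2 ht hle
  · refine ((P.inter_face Ξ hΞ Ξ' hΞ').isExtreme.left_mem_of_mem_openSegment hy h.base_mem
      ⟨h1, h2⟩ ⟨min s s' / t, 1 - min s s' / t, div_pos hm (hm.trans hgt),
        sub_pos.2 ((div_lt_one (hm.trans hgt)).2 hgt), by ring, ?_⟩).2
    have ht0 : t ≠ 0 := (hm.trans hgt).ne'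
    rw [smul_add, smul_smul, div_mul_cancel₀ _ ht0]
    module

/-- There is at most one edge in a given direction at a vertex. -/
theorem eq_of_emanates {Ξ Ξ' : Set (Fin n → ℝ)} (hΞ : Ξ ∈ P.cells) (hΞ' : Ξ' ∈ P.cells)
    {v u : Fin n → ℝ} (h : Emanates Ξ v u) (h' : Emanates Ξ' v u) : Ξ = Ξ' :=
  (P.subset_of_emanates hΞ hΞ' h h').antisymm (P.subset_of_emanates hΞ' hΞ h' h)

/-- The only vertex on a half-line which is a cell is its end. -/
theorem eq_of_mem_halfLine {v u w : Fin n → ℝ} (hcell : halfLine v u ∈ P.cells)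
    (hw : {w} ∈ P.cells) (hmem : w ∈ halfLine v u) : w = v := by
  obtain ⟨t, ht, rfl⟩ := hmem
  have hext := (P.inter_face _ hcell _ hw).isExtreme
  -- The vertex `w` is the midpoint of `v` and `v + 2t u`. As `{w}` is a face of the half-line, it
  -- must contain `v`.
  have := hext.left_mem_of_mem_openSegment (x := v) ⟨0, le_rfl, by simp⟩ (y := v + (2 * t) • u)
    ⟨2 * t, by positivity, rfl⟩ (z := v + t • u) ⟨⟨t, ht, rfl⟩, rfl⟩
    ⟨1 / 2, 1 / 2, by norm_num, by norm_num, by norm_num, by module⟩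
  exact (Set.mem_singleton_iff.1 this.2).symm

theorem mem_coneOver_extend {Ξ : Set (Fin n → ℝ)} (w : Fin n → ℤ) :
    realVec (extend w 1) ∈ coneOver Ξ ↔ realVec w ∈ Ξ := by
  have h1 : realVec (extend w 1) ∘ Sum.inl = realVec w := rfl
  have h2 : realVec (extend w 1) (Sum.inr ()) = 1 := by simp [realVec, extend]
  simp [coneOver, h1, h2]

/-- Cones at infinity lie at height `0`, so only cones over cells can contain `(v, 1)`. -/
theorem exists_cell_of_mem (v : P.Vertex) {κ : Set (Fin n ⊕ Unit → ℝ)}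
    (hκ : κ ∈ P.degenerationFan) (hv : realVec (extend v.1 1) ∈ κ) :
    ∃ Ξ ∈ P.cells, κ = coneOver Ξ ∧ realVec v.1 ∈ Ξ := by
  obtain ⟨Ξ, hΞ, rfl | rfl⟩ := hκ
  · exact ⟨Ξ, hΞ, rfl, (mem_coneOver_extend _).1 hv⟩
  · have := hv.1
    simp [realVec, extend] at this

theorem sub_mem_image_projAlong (v : P.Vertex) {Ξ : Set (Fin n → ℝ)} {x : Fin n → ℝ} (hx : x ∈ Ξ) :
    x - realVec v.1 ∈ P.projAlong v '' coneOver Ξ := by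
  refine ⟨Sum.elim x fun _ => 1, Or.inl ⟨by simp, ?_⟩, ?_⟩
  · simpa using hx
  · ext i
    simp [projAlong]

/-- A cell through `v` whose tangent cone at `v` is `ℝ_{≥ 0} u` emanates from `v` in the
direction `u`. -/
theorem emanates_of_image_projAlong (v : P.Vertex) {Ξ : Set (Fin n → ℝ)} {u : Fin n → ℤ}
    (hv : realVec v.1 ∈ Ξ) (h : P.projAlong v '' coneOver Ξ = rayCone u) :
    Emanates Ξ (realVec v.1) (realVec u) := by
  refine ⟨hv, fun x hx => ?_, ?_⟩
  · obtain ⟨t, ht, hxt⟩ : x - realVec v.1 ∈ rayCone u := h ▸ P.sub_mem_image_projAlong v hx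
    exact ⟨t, ht, by rw [← hxt]; abel⟩
  · obtain ⟨z, hz, hzu⟩ : realVec u ∈ P.projAlong v '' coneOver Ξ :=
      h ▸ ⟨1, zero_le_one, (one_smul _ _).symm⟩
    -- At height `s > 0`, rescaling the preimage `z` of `u` to height `1` gives the point `v + s⁻¹
    -- u` of `Ξ`. At height `0`, `u` itself is a recession direction.
    rcases hz with ⟨hpos, hz⟩ | ⟨hzero, hz⟩
    · refine ⟨(z (Sum.inr ()))⁻¹, inv_pos.2 hpos, ?_⟩
      convert hz using 1
      rw [← hzu, projAlong, smul_sub, smul_smul, inv_mul_cancel₀ hpos.ne']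
      module
    · refine ⟨1, one_pos, ?_⟩
      rw [projAlong, hzero, zero_smul, sub_zero] at hzu
      rw [← hzu]
      exact hz _ hv 1 zero_le_one

/-- The vector `(w, 1)` projects to `w - v`, which must vanish. Thus no other component passes
through a point of the big torus of `X_v`. -/
theorem vertex_eq_of_mem_component {v w : P.Vertex} {x : P.TotalSpace}
    (hw : x ∈ P.component w) (h : P.projAlong v '' x.cone = {0}) : w = v := by
  have h1 : P.projAlong v (realVec (extend w.1 1)) ∈ P.projAlong v '' x.cone := ⟨_, hw, rfl⟩
  rw [h, Set.mem_singleton_iff] at h1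
  apply Subtype.ext
  apply realVec_injective
  funext i
  have := congrFun h1 i
  simp [projAlong, realVec, extend] at this
  simp only [realVec]
  linarith

end PolyhedralDecomposition

/-! ### The cells of the edges of the tropical curve -/

namespace Respects

variable {n : ℕ} {P : PolyhedralDecomposition n} {T : TropicalCurve n} (R : Respects P T)

theorem exists_tgt_eq (E : T.B) : ∃ l : ℝ, 0 < l ∧
    realVec (R.vertex (T.tgt E)).1 =
      realVec (R.vertex (T.src E)).1 + l • realVec (T.dirB E) := by
  obtain ⟨l, hl, h⟩ := T.edge E
  refine ⟨R.scale * l, mul_pos (by exact_mod_cast R.scale_pos) (by exact_mod_cast hl), ?_⟩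
  rw [R.vertex_eq, R.vertex_eq]
  ext i
  simp only [TropicalCurve.posR, h, Pi.smul_apply, Pi.add_apply, smul_eq_mul, realVec]
  push_cast
  ring

/-- An edge has positive length in a nonzero direction. This puts the two branches at each node into
different components of the central fiber. -/
theorem vertex_src_ne_tgt (E : T.B) : R.vertex (T.src E) ≠ R.vertex (T.tgt E) := by
  obtain ⟨l, hl, h⟩ := R.exists_tgt_eq E
  intro he
  rw [he, left_eq_add, smul_eq_zero] at h
  exact h.elim hl.ne' (realVec_ne_zero (T.dirB_primitive E).ne_zero)

/-- The cell of a bounded edge. -/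
def cellB (E : T.B) : Set (Fin n → ℝ) :=
  segment ℝ (realVec (R.vertex (T.src E)).1) (realVec (R.vertex (T.tgt E)).1)

theorem emanates_src (E : T.B) :
    Emanates (R.cellB E) (realVec (R.vertex (T.src E)).1) (realVec (T.dirB E)) := by
  obtain ⟨l, hl, h⟩ := R.exists_tgt_eq E
  refine ⟨left_mem_segment _ _ _, ?_, l, hl, h ▸ right_mem_segment _ _ _⟩
  rintro _ ⟨a, b, ha, hb, hab, rfl⟩
  refine ⟨b * l, by positivity, ?_⟩
  obtain rfl : a = 1 - b := by linarith
  rw [h]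
  module

theorem emanates_tgt (E : T.B) :
    Emanates (R.cellB E) (realVec (R.vertex (T.tgt E)).1) (realVec (-T.dirB E)) := by
  have hneg : realVec (-T.dirB E) = -realVec (T.dirB E) := by ext i; simp [realVec]
  obtain ⟨l, hl, h⟩ := R.exists_tgt_eq E
  refine ⟨right_mem_segment _ _ _, ?_, l, hl, ?_⟩
  · rintro _ ⟨a, b, ha, hb, hab, rfl⟩
    refine ⟨a * l, by positivity, ?_⟩
    obtain rfl : a = 1 - b := by linarith
    rw [h, hneg]
    module
  · have : realVec (R.vertex (T.tgt E)).1 + l • realVec (-T.dirB E) =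
        realVec (R.vertex (T.src E)).1 := by rw [h, hneg]; module
    exact this ▸ left_mem_segment _ _ _

theorem emanates_base (E : T.U) :
    Emanates (halfLine (realVec (R.vertex (T.base E)).1) (realVec (T.dirU E)))
      (realVec (R.vertex (T.base E)).1) (realVec (T.dirU E)) :=
  ⟨⟨0, le_rfl, by simp⟩, subset_rfl, 1, one_pos, 1, zero_le_one, rfl⟩

end Respects

/-! ## The action of the torus -/

/-- The value of the character `m` at the point `exp a` of the torus. -/
noncomputable def expChar {ι : Type} [Fintype ι] (a : ι → ℂ) (m : ι → ℤ) : ℂ :=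
  Complex.exp (∑ i, (m i : ℂ) * a i)

theorem expChar_ne_zero {ι : Type} [Fintype ι] (a : ι → ℂ) (m : ι → ℤ) : expChar a m ≠ 0 :=
  Complex.exp_ne_zero _

theorem expChar_add {ι : Type} [Fintype ι] (a : ι → ℂ) (m m' : ι → ℤ) :
    expChar a (m + m') = expChar a m * expChar a m' := by
  simp [expChar, ← Complex.exp_add, add_mul, Finset.sum_add_distrib]

section ToricVariety

variable {ι : Type} [Fintype ι] {𝓕 : Set (Set (ι → ℝ))}

/-- The action of the point `exp a` of the torus on a toric variety. -/
@[simps]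
noncomputable def ToricVariety.expAct (a : ι → ℂ) (x : ToricVariety 𝓕) : ToricVariety 𝓕 where
  cone := x.cone
  cone_mem := x.cone_mem
  ev m := expChar a m * x.ev m
  ev_ne_zero_iff m := by simp [expChar_ne_zero, ← x.ev_ne_zero_iff]
  ev_add m m' hm hm' := by rw [expChar_add, x.ev_add m m' hm hm']; ring

theorem ToricVariety.expAct_injective (a : ι → ℂ) :
    Function.Injective (ToricVariety.expAct (𝓕 := 𝓕) a) := fun _ _ h =>
  ToricVariety.ext (congrArg ToricVariety.cone h :) (funext fun m =>
    mul_left_cancel₀ (expChar_ne_zero a m) (congrFun (congrArg ToricVariety.ev h) m :))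

theorem analyticOrderAt_const_mul {c : ℂ} (hc : c ≠ 0) (f : ℂ → ℂ) (z : ℂ) :
    analyticOrderAt (fun x => c * f x) z = analyticOrderAt f z := by
  by_cases hf : AnalyticAt ℂ f z
  -- A non-analytic function has order `0` by convention, so the other case needs that `c * f` is
  -- not analytic either; this follows by multiplying with `c⁻¹`.
  · have h := analyticOrderAt_mul (analyticAt_const (v := c)) hf
    rw [analyticAt_const.analyticOrderAt_eq_zero.2 hc, zero_add] at h
    exact h
  · rw [analyticOrderAt_of_not_analyticAt hf, analyticOrderAt_of_not_analyticAt]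
    intro h
    apply hf
    have h' := (analyticAt_const (v := c⁻¹)).mul h
    refine h'.congr (Filter.Eventually.of_forall fun x => ?_)
    simp [hc]

variable {f : P1 → ToricVariety 𝓕}

theorem IsHolomorphic.expAct (hf : IsHolomorphic f) (a : ι → ℂ) :
    IsHolomorphic fun q => (f q).expAct a := fun p => by
  obtain ⟨σ, hσ, hcone, han⟩ := hf p
  exact ⟨σ, hσ, hcone, fun m hm => analyticAt_const.mul (han m hm)⟩

theorem IsToricallyTransverse.expAct (hf : IsToricallyTransverse f) (a : ι → ℂ) :
    IsToricallyTransverse fun q => (f q).expAct a :=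
  ⟨hf.1.expAct a, hf.2.1, hf.2.2⟩

theorem MeetsDivisor.expAct {p : P1} {u : ι → ℤ} {w : ℕ} (hf : MeetsDivisor f p u w) (a : ι → ℂ) :
    MeetsDivisor (fun q => (f q).expAct a) p u w :=
  ⟨hf.1, hf.2.1, fun m hm =>
    (analyticOrderAt_const_mul (expChar_ne_zero a m) _ _).trans (hf.2.2 m hm)⟩

/-- The torus preserves every orbit and multiplies each character by a nonzero constant, so
incidences, multiplicities and marked points are unchanged. -/
theorem IsOfVertexType.expAct {A : Type} {u : A → (ι → ℤ)} {w : A → ℕ} {p : A → P1}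
    (hf : IsOfVertexType f u w p) (a : ι → ℂ) :
    IsOfVertexType (fun q => (f q).expAct a) u w p where
  nonconstant := by
    obtain ⟨q, q', h⟩ := hf.nonconstant
    exact ⟨q, q', fun h' => h (ToricVariety.expAct_injective a h')⟩
  transverse := hf.transverse.expAct a
  injective := hf.injective
  meets e := (hf.meets e).expAct a
  only := hf.only

end ToricVariety

/-! ### The torus action on the components of the central fiber -/

namespace PolyhedralDecomposition

variable {n : ℕ} {P : PolyhedralDecomposition n}

/-- The action of the point `exp a` of the torus on a component of the central fiber. -/
noncomputable def expAct (v : P.Vertex) (a : Fin n → ℂ) (x : P.component v) : P.component v :=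
  ⟨x.1.expAct (Sum.elim a 0), x.2⟩

/-- The last torus coordinate is `exp 0 = 1`. Hence the shift `- ⟨m, v⟩` in the characters of `X_v`
has no effect, and the same `a` acts compatibly on all components. -/
theorem expChar_extend (a : Fin n → ℂ) (m : Fin n → ℤ) (k : ℤ) :
    expChar (Sum.elim a 0) (extend m k) = expChar a m := by
  simp [expChar, extend]

theorem toToric_expAct (v : P.Vertex) (a : Fin n → ℂ) (x : P.component v) :
    P.toToric v (P.expAct v a x) = (P.toToric v x).expAct a :=
  ToricVariety.ext rfl (funext fun m => by
    simp [toToric, expAct, expChar_extend])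

/-- Two points of the same orbit, of a cone which is a ray modulo `(v, 1)`, can be moved to the same
point by the torus; the stabilizer contains the one-parameter subgroup of the ray. -/
theorem exists_expAct_eq {v v' : P.Vertex} (x : P.component v) (y : P.component v')
    (hcone : x.1.cone = y.1.cone) {u : Fin n → ℤ}
    (hu : P.projAlong v '' x.1.cone = rayCone u) :
    ∃ b : Fin n → ℂ, ∀ (a a' : Fin n → ℂ) (l : ℂ), (∀ i, a' i - a i = b i + l * (u i : ℂ)) →
      (P.expAct v a x).1 = (P.expAct v' a' y).1 := by
  let ex : (Fin n → ℤ) → (Fin n ⊕ Unit → ℤ) := fun m => extend m (- ∑ i, m i * v.1 i)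
  have ex_add : ∀ m m', ex (m + m') = ex m + ex m' := fun m m' => by
    funext j
    cases j with
    | inl i => simp [ex, extend]
    | inr i => simp [ex, extend, add_mul, Finset.sum_add_distrib]; ring
  -- The image of `L = u^⊥` under `ex` is the character lattice of the orbit containing `x` and `y`.
  let L : Submodule ℤ (Fin n → ℤ) := LinearMap.ker (Fintype.linearCombination ℤ u)
  have hL : ∀ m, m ∈ L ↔ ∑ i, m i * u i = 0 := fun m => by
    simp [L, Fintype.linearCombination_apply]
  have hperp : ∀ m ∈ L, ∀ z ∈ x.1.cone, pairing (ex m) z = 0 := fun m hm z hz => by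
    obtain ⟨t, -, ht⟩ : P.projAlong v z ∈ rayCone u := hu ▸ ⟨z, hz, rfl⟩
    have h1 : ∑ i, (m i : ℝ) * (u i : ℝ) = 0 := by exact_mod_cast (hL m).1 hm
    rw [pairing_extend, ht]
    simp [pairing, realVec, mul_left_comm, ← Finset.mul_sum, h1]
  have hx0 : ∀ m ∈ L, x.1.ev (ex m) ≠ 0 := fun m hm => (x.1.ev_ne_zero_iff _).2 (hperp m hm)
  have hy0 : ∀ m ∈ L, y.1.ev (ex m) ≠ 0 := fun m hm =>
    (y.1.ev_ne_zero_iff _).2 (hcone ▸ hperp m hm)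
  -- The ratio of the two points is a homomorphism from `L` to `ℂ^*`; `b` is a logarithm of it.
  obtain ⟨b, hb⟩ := exists_exp_eq L (fun m => x.1.ev (ex m) / y.1.ev (ex m))
    (fun m hm => div_ne_zero (hx0 m hm) (hy0 m hm))
    (fun m hm m' hm' => by
      rw [ex_add, x.1.ev_add _ _ (hperp m hm) (hperp m' hm'),
        y.1.ev_add _ _ (hcone ▸ hperp m hm) (hcone ▸ hperp m' hm'), mul_div_mul_comm])
  refine ⟨b, fun a a' l h => ToricVariety.ext hcone (funext fun m' => ?_)⟩
  change expChar (Sum.elim a 0) m' * x.1.ev m' = expChar (Sum.elim a' 0) m' * y.1.ev m'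
  -- Only characters orthogonal to the cone matter, since all others vanish at both points.
  -- Orthogonality to `(v, 1)` determines the last coordinate of `m'`, and orthogonality to a lift
  -- of `u` puts its remaining part into `L`.
  by_cases hm' : ∀ z ∈ x.1.cone, pairing m' z = 0
  · obtain ⟨m, rfl⟩ : ∃ m, m' = ex m := by
      refine ⟨m' ∘ Sum.inl, funext fun j => ?_⟩
      cases j with
      | inl i => rfl
      | inr i =>
        have h1 := hm' _ x.2
        simp only [pairing, realVec, extend, Fintype.sum_sum_type, Sum.elim_inl, Sum.elim_inr,
          Finset.univ_unique, Finset.sum_singleton, Int.cast_one, mul_one] at h1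
        have h2 : ∑ i, m' (Sum.inl i) * v.1 i + m' (Sum.inr ()) = 0 := by exact_mod_cast h1
        change m' (Sum.inr ()) = - ∑ i, m' (Sum.inl i) * v.1 i
        linarith
    have hm : m ∈ L := by
      obtain ⟨z, hz, hzu⟩ : realVec u ∈ P.projAlong v '' x.1.cone :=
        hu ▸ ⟨1, zero_le_one, (one_smul _ _).symm⟩
      have h1 := hm' z hz
      rw [pairing_extend, hzu] at h1
      rw [hL]
      simp only [pairing, realVec] at h1
      exact_mod_cast h1
    have h1 := hb m hm
    have h2 : expChar a' m = expChar a m * (x.1.ev (ex m) / y.1.ev (ex m)) := by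
      rw [← h1, expChar, expChar, ← Complex.exp_add, ← Finset.sum_add_distrib]
      congr 1
      -- The term `l u` is invisible to the characters in `L`, which is what leaves `l` free.
      have h3 : ∑ i, (m i : ℂ) * (u i : ℂ) = 0 := by exact_mod_cast (hL m).1 hm
      have h4 : ∑ i, (m i : ℂ) * a' i = ∑ i, ((m i : ℂ) * a i + (m i : ℂ) * b i) +
          l * ∑ i, (m i : ℂ) * (u i : ℂ) := by
        rw [Finset.mul_sum, ← Finset.sum_add_distrib]
        refine Finset.sum_congr rfl fun i _ => ?_
        linear_combination (m i : ℂ) * h i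
      rw [h4, h3, mul_zero, add_zero]
    simp only [ex] at h2 hy0 ⊢
    rw [expChar_extend, expChar_extend, h2, mul_assoc, div_mul_cancel₀ _ (hy0 m hm)]
  · have hx : x.1.ev m' = 0 := by
      by_contra h0
      exact hm' ((x.1.ev_ne_zero_iff _).1 h0)
    have hy : y.1.ev m' = 0 := by
      by_contra h0
      exact hm' (hcone ▸ (y.1.ev_ne_zero_iff _).1 h0)
    rw [hx, hy, mul_zero, mul_zero]

end PolyhedralDecomposition

/-! ## Curves of vertex type -/

section OfTypeAt

variable {n : ℕ} {P : PolyhedralDecomposition n} {T : TropicalCurve n} {R : Respects P T}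

theorem IsOfTypeAt.expAct {v : T.V} {f : P1 → P.component (R.vertex v)} {mark : T.FlagAt v → P1}
    (h : IsOfTypeAt R v f mark) (a : Fin n → ℂ) :
    IsOfTypeAt R v (fun q => P.expAct (R.vertex v) a (f q)) mark := by
  unfold IsOfTypeAt
  simp only [PolyhedralDecomposition.toToric_expAct]
  exact IsOfVertexType.expAct h a

/-- At the marked point of a flag, a curve of vertex type meets the stratum of any cell which
emanates from the vertex in the direction of the flag. -/
theorem IsOfTypeAt.cone_mark {v : T.V} {f : P1 → P.component (R.vertex v)}
    {mark : T.FlagAt v → P1} (h : IsOfTypeAt R v f mark) (e : T.FlagAt v)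
    {Ξ : Set (Fin n → ℝ)} (hΞ : Ξ ∈ P.cells)
    (hem : Emanates Ξ (realVec (R.vertex v).1) (realVec (T.flagDir e.1))) :
    (f (mark e)).1.cone = coneOver Ξ := by
  -- The divisor condition only fixes the tangent cone at `v` of the cell `Ξ'` of the marked point;
  -- uniqueness of the cell in a given direction identifies `Ξ'` with `Ξ`.
  obtain ⟨Ξ', hΞ', hc, hv⟩ :=
    P.exists_cell_of_mem (R.vertex v) (f (mark e)).1.cone_mem (f (mark e)).2
  have h1 : P.projAlong (R.vertex v) '' (f (mark e)).1.cone = rayCone (T.flagDir e.1) :=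
    (h.meets e).2.1
  rw [hc] at h1
  rw [hc, P.eq_of_emanates hΞ' hΞ (P.emanates_of_image_projAlong _ hv h1) hem]

/-- A curve of vertex type meets the singular locus only at the marked points of the bounded
edges. -/
theorem IsOfTypeAt.exists_bounded {v : T.V} {f : P1 → P.component (R.vertex v)}
    {mark : T.FlagAt v → P1} (h : IsOfTypeAt R v f mark) {q : P1}
    (hq : (f q).1 ∈ P.singularLocus) :
    ∃ (E : T.B) (b : Bool) (hE : T.flagVertex (Sum.inl (E, b)) = v),
      q = mark ⟨Sum.inl (E, b), hE⟩ := by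
  -- A singular point lies on two components, so it is enough that only `X_v` passes through every
  -- point other than the marked points of bounded edges.
  suffices h' : (∀ w : P.Vertex, (f q).1 ∈ P.component w → w = R.vertex v) ∨
      ∃ (E : T.B) (b : Bool) (hE : T.flagVertex (Sum.inl (E, b)) = v),
        q = mark ⟨Sum.inl (E, b), hE⟩ by
    refine h'.resolve_left fun h1 => ?_
    obtain ⟨w, w', hne, hw, hw'⟩ := hq
    exact hne ((h1 w hw).trans (h1 w' hw').symm)
  by_cases hmem : q ∈ Set.range mark
  · obtain ⟨⟨⟨E, b⟩ | E, rfl⟩, rfl⟩ := hmem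
    · exact Or.inr ⟨E, b, rfl, rfl⟩
    · refine Or.inl fun w hw => ?_
      -- An unbounded edge is a half-line whose only vertex is its end, so its divisor lies on no
      -- second component.
      have hcell : halfLine (realVec (R.vertex (T.base E)).1) (realVec (T.dirU E)) ∈ P.cells :=
        R.edgeU_mem E
      have hc := h.cone_mark ⟨Sum.inr E, rfl⟩ hcell (R.emanates_base E)
      have hw' : realVec (extend w.1 1) ∈ (f (mark ⟨Sum.inr E, rfl⟩)).1.cone := hw
      rw [hc, PolyhedralDecomposition.mem_coneOver_extend] at hw'
      exact Subtype.ext (realVec_injective (P.eq_of_mem_halfLine hcell w.2 hw'))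
  · exact Or.inl fun w hw => P.vertex_eq_of_mem_component hw (h.only q hmem)

end OfTypeAt

/-! ## Gluing -/

section Glue

variable {n : ℕ} {P : PolyhedralDecomposition n} {T : TropicalCurve n}

/-- The prestable curve with dual graph `T` obtained by gluing the marked points. -/
def gluedCurve (T : TropicalCurve n) (mark : (v : T.V) → T.FlagAt v → P1)
    (hmark : ∀ v, Function.Injective (mark v)) : PrestableCurve where
  comp := T.V
  node := T.B
  finComp := inferInstance
  finNode := inferInstance
  branch E b := ⟨T.flagVertex (Sum.inl (E, b)), mark _ ⟨Sum.inl (E, b), rfl⟩⟩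
  branch_injective := by
    rintro ⟨E, b⟩ ⟨E', b'⟩ h
    -- The vertices are kept independent here, so that their equality can be substituted before the
    -- injectivity of `mark` at a single vertex is applied.
    have key : ∀ {v v' : T.V} (e : T.FlagAt v) (e' : T.FlagAt v'),
        ((v, mark v e) : T.V × P1) = (v', mark v' e') → e.1 = e'.1 := by
      intro v v' e e' h
      obtain ⟨rfl, h2⟩ := Prod.mk.inj h
      rw [hmark _ h2]
    exact Sum.inl_injective (key _ _ h)
  nonempty := T.connected.1
  connected := T.connected.2

variable {R : Respects P T}

/-- Curves of vertex type which agree at the marked points of the bounded edges glue to a pre-log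
curve. -/
def gluedPreLogCurve (f : (v : T.V) → P1 → P.component (R.vertex v))
    (mark : (v : T.V) → T.FlagAt v → P1) (hf : ∀ v, IsOfTypeAt R v (f v) (mark v))
    (hglue : ∀ E, (f (T.src E) (mark (T.src E) ⟨Sum.inl (E, false), rfl⟩)).1 =
      (f (T.tgt E) (mark (T.tgt E) ⟨Sum.inl (E, true), rfl⟩)).1) : PreLogCurve P where
  toPrestableCurve := gluedCurve T mark fun v => (hf v).injective
  vertex := R.vertex
  map := f
  glue := hglue
  -- Curves of vertex type are non-constant, so no component is contracted.
  stable := by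
    rintro v ⟨x, hx⟩
    obtain ⟨q, q', h⟩ := (hf v).nonconstant
    exact absurd (by rw [hx, hx]) h
  transverse v := (hf v).transverse
  node_of_singular v q hq := by
    obtain ⟨E, b, rfl, rfl⟩ := (hf v).exists_bounded hq
    exact ⟨E, b, rfl⟩
  -- Both branches meet the divisor with multiplicity the weight of `E`, in opposite directions.
  node_condition E _ := ⟨R.vertex_src_ne_tgt E, T.weightB E, T.dirB E, -T.dirB E,
    (hf (T.src E)).meets ⟨Sum.inl (E, false), rfl⟩, (hf (T.tgt E)).meets ⟨Sum.inl (E, true), rfl⟩⟩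

/-- The glued pre-log curve is of the type of the tropical curve. -/
def gluedOfType (f : (v : T.V) → P1 → P.component (R.vertex v))
    (mark : (v : T.V) → T.FlagAt v → P1) (hf : ∀ v, IsOfTypeAt R v (f v) (mark v))
    (hglue : ∀ E, (f (T.src E) (mark (T.src E) ⟨Sum.inl (E, false), rfl⟩)).1 =
      (f (T.tgt E) (mark (T.tgt E) ⟨Sum.inl (E, true), rfl⟩)).1) :
    (gluedPreLogCurve f mark hf hglue).OfType R where
  comp := Equiv.refl _
  node := Equiv.refl _
  mark := mark
  map := f
  vertex_eq _ := rfl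
  map_eq _ _ := rfl
  type := hf
  node_eq _ := rfl

end Glue

end TropicalPreLog

theorem proposition5p24 (n : ℕ) (hn : 2 ≤ n) (T : TropicalCurve n)
    (hemb : T.IsEmbedded) (hns : T.IsNonSuperabundant)
    (P : PolyhedralDecomposition n) (R : Respects P T)
    (C : (v : T.V) → P1 → P.component (R.vertex v))
    (mark : (v : T.V) → T.FlagAt v → P1)
    (hC : ∀ v, IsOfTypeAt R v (C v) (mark v)) :
    ∃ (φ : PreLogCurve P) (τ : φ.OfType R),
      ∀ v, ∃ g : Matrix.GeneralLinearGroup (Fin 2) ℂ, ∀ e, g • mark v e = τ.mark v e := by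
  -- The segment of `E` emanates from both of its ends, so the two marked points have the same cone.
  have hex := fun E : T.B => PolyhedralDecomposition.exists_expAct_eq
    (C (T.src E) (mark (T.src E) ⟨Sum.inl (E, false), rfl⟩))
    (C (T.tgt E) (mark (T.tgt E) ⟨Sum.inl (E, true), rfl⟩))
    (((hC _).cone_mark ⟨Sum.inl (E, false), rfl⟩ (R.edgeB_mem E) (R.emanates_src E)).trans
      ((hC _).cone_mark ⟨Sum.inl (E, true), rfl⟩ (R.edgeB_mem E) (R.emanates_tgt E)).symm)
    (u := T.dirB E) ((hC (T.src E)).meets ⟨Sum.inl (E, false), rfl⟩).2.1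
  choose b hb using hex
  obtain ⟨a, l, hal⟩ := hns.exists_complex T b
  exact ⟨_, gluedOfType (fun v q => P.expAct (R.vertex v) (a v) (C v q)) mark
    (fun v => (hC v).expAct (a v)) (fun E => hb E _ _ (l E) (hal E)),
    -- The torus moves the maps but not the marked points, so the identity is the required
    -- isomorphism.
    fun v => ⟨1, fun e => one_smul _ _⟩⟩
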